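/- For a pure three-qubit state $|\psi\rangle$ (a unit vector of $\mathbb C^2\otimes\mathbb C^2\otimes\mathbb C^2$) let $\rho_i$ be the reduced density matrix of qubit $i$, and let $C_{i(jk)}=\sqrt{2(1-\operatorname{Tr}\rho_i^2)}$, $\{i,j,k\}=\{1,2,3\}$, be the three one-to-other concurrences. Then $C_{i(jk)}^2\le C_{j(ki)}^2+C_{k(ij)}^2$ for every choice of $i$, so that the numbers $C_{1(23)}^2$, $C_{2(13)}^2$, $C_{3(12)}^2$ are the edge lengths of a (possibly degenerate) triangle, the concurrence triangle. Its normalized area, the concurrence fill $$F_{123}(\psi)=\frac{4}{\sqrt3}\sqrt{Q\,\bigl(Q-C_{1(23)}^2\bigr)\bigl(Q-C_{2(13)}^2\bigr)\bigl(Q-C_{3(12)}^2\bigr)},\qquad Q=\tfrac12\bigl(C_{1(23)}^2+C_{2(13)}^2+C_{3(12)}^2\bigr),$$ is a genuine tripartite entanglement measure for pure three-qubit states, that is: (a) $F_{123}(\psi)=0$ for every product state and for every biseparable state $\psi$ (a state in which at least one qubit factors out from the other two); (b) $F_{123}(\psi)>0$ for every state $\psi$ that is not product or biseparable; in particular, for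 every state of the GHZ class and of the W class, that is, for every state $(A_1\otimes A_2\otimes A_3)|\chi\rangle$ with invertible $2\times2$ matrices $A_i$ and $|\chi\rangle=\frac1{\sqrt2}(|000\rangle+|111\rangle)$ or $|\chi\rangle=\frac1{\sqrt3}(|100\rangle+|010\rangle+|001\rangle)$; (c) $F_{123}$ is non-increasing under local operations and classical communication: if a protocol with finitely many rounds, in each of which one party performs a generalized measurement with finitely many outcomes on its own qubit and announces the outcome, on which all later steps may depend, transforms the pure state $\psi$ into the pure state $\varphi$, i.e. its quantum operation $\Lambda$ satisfies $\Lambda(|\psi\rangle\langle\psi|)=|\varphi\rangle\langle\varphi|$, then $F_{123}(\varphi)\le F_{123}(\psi)$. -/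

import Mathlib

noncomputable section

namespace ThreeQubit

/-- Vectors of the three-qubit Hilbert space `ℂ² ⊗ ℂ² ⊗ ℂ²`, as amplitudes in the computational
basis `|s 0, s 1, s 2⟩`. A (pure) state is a vector of norm one. -/
abbrev Vec : Type := EuclideanSpace ℂ (Fin 3 → Fin 2)

/-- The reduced density matrix of qubit `i`: the partial trace of `|ψ⟩⟨ψ|` over the two other
qubits. -/
def reducedDensity (i : Fin 3) (ψ : Vec) : Matrix (Fin 2) (Fin 2) ℂ :=
  Matrix.of fun a b =>
    ∑ s : Fin 3 → Fin 2, if s i = a then ψ s * star (ψ (Function.update s i b)) else 0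

/-- The one-to-other concurrence `C_{i(jk)} = √(2 (1 - Tr ρ_i²))` of a pure state. -/
def concurrence (i : Fin 3) (ψ : Vec) : ℝ :=
  Real.sqrt (2 * (1 - (reducedDensity i ψ * reducedDensity i ψ).trace.re))

/-- The length of edge `i` of the concurrence triangle: the squared one-to-other concurrence. -/
def edge (i : Fin 3) (ψ : Vec) : ℝ := concurrence i ψ ^ 2

/-- Half of the perimeter of the concurrence triangle. -/
def halfPerimeter (ψ : Vec) : ℝ := (edge 0 ψ + edge 1 ψ + edge 2 ψ) / 2

/-- The concurrence fill: the area of the concurrence triangle by Heron's formula, normalized by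
the prefactor `4 / √3`. -/
def concurrenceFill (ψ : Vec) : ℝ :=
  4 / Real.sqrt 3 *
    Real.sqrt (halfPerimeter ψ * (halfPerimeter ψ - edge 0 ψ) * (halfPerimeter ψ - edge 1 ψ) *
      (halfPerimeter ψ - edge 2 ψ))

/-- Product vectors `u₀ ⊗ u₁ ⊗ u₂`. -/
def IsProduct (ψ : Vec) : Prop :=
  ∃ u : Fin 3 → Fin 2 → ℂ, ∀ s, ψ s = ∏ i, u i (s i)

/-- Biseparable vectors: some qubit `i` factors out, `ψ = u ⊗ v` with `u` a vector of qubit `i` and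
`v` a (possibly entangled) vector of the two other qubits. -/
def IsBiseparable (ψ : Vec) : Prop :=
  ∃ (i : Fin 3) (u : Fin 2 → ℂ) (v : ({j : Fin 3 // j ≠ i} → Fin 2) → ℂ),
    ∀ s, ψ s = u (s i) * v (fun j => s j)

/-- The operator on three qubits that applies `M` to qubit `i` and the identity to the others. -/
def localOp (i : Fin 3) (M : Matrix (Fin 2) (Fin 2) ℂ) :
    Matrix (Fin 3 → Fin 2) (Fin 3 → Fin 2) ℂ :=
  Matrix.of fun s t => if ∀ j, j ≠ i → s j = t j then M (s i) (t i) else 0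

/-- The state `(|000⟩ + |111⟩) / √2`. -/
def ghz : Vec :=
  WithLp.toLp 2 fun s => if s = ![0, 0, 0] ∨ s = ![1, 1, 1] then ((1 / Real.sqrt 2 : ℝ) : ℂ) else 0

/-- The state `(|100⟩ + |010⟩ + |001⟩) / √3`. -/
def wState : Vec :=
  WithLp.toLp 2 fun s =>
    if s = ![1, 0, 0] ∨ s = ![0, 1, 0] ∨ s = ![0, 0, 1] then ((1 / Real.sqrt 3 : ℝ) : ℂ) else 0

/-- `ψ = (A₀ ⊗ A₁ ⊗ A₂) χ` with invertible local operators `Aᵢ`: the two vectors are equivalent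
under stochastic local operations and classical communication. -/
def InClassOf (χ ψ : Vec) : Prop :=
  ∃ A : Fin 3 → Matrix (Fin 2) (Fin 2) ℂ, (∀ i, IsUnit (A i)) ∧
    ∀ s, ψ s = ∑ t : Fin 3 → Fin 2, (∏ i, A i (s i) (t i)) * χ t

/-- The GHZ class. -/
def IsGHZClass (ψ : Vec) : Prop := InClassOf ghz ψ

/-- The W class. -/
def IsWClass (ψ : Vec) : Prop := InClassOf wState ψ

/-- The density matrix `|ψ⟩⟨ψ|`. -/
def pureDensity (ψ : Vec) : Matrix (Fin 3 → Fin 2) (Fin 3 → Fin 2) ℂ :=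
  Matrix.of fun s t => ψ s * star (ψ t)

/-- Protocols of local operations and classical communication on three qubits, with finitely many
rounds. In each round one party `i` performs a generalized measurement on its qubit, given by Kraus
operators `M k` with `∑ₖ (M k)ᴴ * M k = 1`, and announces the outcome `k`, on which the whole
continuation of the protocol may depend. -/
inductive LOCCProtocol : Type
  | halt : LOCCProtocol
  | measure (i : Fin 3) (n : ℕ) (M : Fin n → Matrix (Fin 2) (Fin 2) ℂ)
      (complete : ∑ k, (M k).conjTranspose * M k = 1) (next : Fin n → LOCCProtocol) : LOCCProtocol

/-- The quantum operation on density matrices that a protocol carries out. -/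
def LOCCProtocol.channel : LOCCProtocol → Matrix (Fin 3 → Fin 2) (Fin 3 → Fin 2) ℂ →
    Matrix (Fin 3 → Fin 2) (Fin 3 → Fin 2) ℂ
  | .halt, ρ => ρ
  | .measure i _ M _ next, ρ =>
      ∑ k, (next k).channel (localOp i (M k) * ρ * (localOp i (M k)).conjTranspose)

/-- Genuine tripartite entanglement measures for pure three-qubit states. -/
structure IsGenuineTripartiteMeasure (E : Vec → ℝ) : Prop where
  /-- Zero on all product and biseparable states. -/
  eq_zero : ∀ ψ : Vec, ‖ψ‖ = 1 → IsProduct ψ ∨ IsBiseparable ψ → E ψ = 0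
  /-- Positive on all non-biseparable states. -/
  pos : ∀ ψ : Vec, ‖ψ‖ = 1 → ¬ IsProduct ψ → ¬ IsBiseparable ψ → 0 < E ψ
  /-- In particular positive on the GHZ class and on the W class. -/
  pos_of_class : ∀ ψ : Vec, ‖ψ‖ = 1 → IsGHZClass ψ ∨ IsWClass ψ → 0 < E ψ
  /-- Non-increasing under local operations and classical communication. -/
  locc_mono : ∀ (P : LOCCProtocol) (ψ φ : Vec), ‖ψ‖ = 1 → ‖φ‖ = 1 →
    P.channel (pureDensity ψ) = pureDensity φ → E φ ≤ E ψ

end ThreeQubit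

end

namespace ThreeQubit

open ComplexConjugate

/-! Slicing ψ along qubit i gives two 2×2 matrices. Let T_i (`form`) be the symmetric matrix of the
determinant, polarized, on their combinations, and Z_i = ‖T_i‖² in Frobenius norm. For unit ψ, C_i²
= 4 det ρ_i = Z_j + Z_k (`four_mul_det_density`, `edge_eq`). So the triangle inequality is Z_i ≥ 0,
and Heron's product is Z₀Z₁Z₂(Z₀+Z₁+Z₂) (`concurrenceFill_eq`). It vanishes iff some T_i = 0, which
happens iff a qubit other than i factors out (`exists_factor_of_form_eq_zero`,
`form_rot_of_factor`).

For monotonicity, a Kraus operator M on qubit i sends T_i to M T_i Mᵀ and multiplies the other two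
forms by det M. Heron's product then grows at most by the factor `rate`⁸ (`heron_act_le`), and the
rates of a complete measurement sum to 1 when T_i ≠ 0 (`sum_rate`). Hence the eighth root of Heron's
product, homogeneous of degree one in |ψ⟩⟨ψ|, does not increase when summed over unnormalized
branches. A pure final state forces every branch to end in a multiple of it, so induction on the
protocol applies (`mul_heron_rpow_le`). -/

/-- The amplitudes of three qubits, one index per qubit. -/
abbrev Tensor : Type := Fin 2 → Fin 2 → Fin 2 → ℂ

namespace Tensor

/-- Cyclic relabelling that brings the second qubit to the front. -/
def rot (x : Tensor) : Tensor := fun a b c => x c a b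

/-- The operator `M` applied to the first qubit. -/
def act (M : Matrix (Fin 2) (Fin 2) ℂ) (x : Tensor) : Tensor := fun a b c => ∑ a', M a a' * x a' b c

/-- The polarized determinant of the slices of a tensor along the first qubit. -/
def form (x : Tensor) : Matrix (Fin 2) (Fin 2) ℂ :=
  Matrix.of fun a b => x a 0 0 * x b 1 1 + x a 1 1 * x b 0 0 - x a 0 1 * x b 1 0 - x a 1 0 * x b 0 1

end Tensor

/-! ### Norm inequalities for 2×2 matrices -/

/-- The squared Frobenius norm of a `2 × 2` matrix. -/
def frobSq (T : Matrix (Fin 2) (Fin 2) ℂ) : ℝ := ∑ a, ∑ b, Complex.normSq (T a b)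

theorem frobSq_nonneg (T : Matrix (Fin 2) (Fin 2) ℂ) : 0 ≤ frobSq T :=
  Finset.sum_nonneg fun _ _ => Finset.sum_nonneg fun _ _ => Complex.normSq_nonneg _

theorem frobSq_eq_zero {T : Matrix (Fin 2) (Fin 2) ℂ} (h : frobSq T = 0) : T = 0 := by
  ext a b
  have h1 := (Finset.sum_eq_zero_iff_of_nonneg fun a _ =>
    Finset.sum_nonneg fun b _ => Complex.normSq_nonneg (T a b)).1 h a (Finset.mem_univ a)
  have h2 := (Finset.sum_eq_zero_iff_of_nonneg fun b _ =>
    Complex.normSq_nonneg (T a b)).1 h1 b (Finset.mem_univ b)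
  simpa using h2

theorem frobSq_smul (d : ℂ) (T : Matrix (Fin 2) (Fin 2) ℂ) :
    frobSq (d • T) = Complex.normSq d * frobSq T := by
  simp [frobSq, Fin.sum_univ_two, Complex.normSq_mul]
  ring

theorem ofReal_frobSq (T : Matrix (Fin 2) (Fin 2) ℂ) :
    (frobSq T : ℂ) = ∑ a, ∑ b, T a b * conj (T a b) := by
  simp [frobSq, Complex.mul_conj]

/-- The defect is an explicit square: with H = MᴴM, it is |(HT − (HT)ᵀ)₀₁|². -/
theorem normSq_det_mul_frobSq_add_le (M T : Matrix (Fin 2) (Fin 2) ℂ) (hT : T 0 1 = T 1 0) :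
    Complex.normSq M.det * frobSq T + frobSq (M * T * M.transpose) ≤ frobSq M * frobSq (M * T) := by
  have key : Complex.normSq M.det * frobSq T + frobSq (M * T * M.transpose) +
      Complex.normSq ((M.conjTranspose * M * T - T * (M.conjTranspose * M).transpose) 0 1) =
      frobSq M * frobSq (M * T) := by
    rw [← Complex.ofReal_inj]
    push_cast
    simp only [ofReal_frobSq, ← Complex.mul_conj, Matrix.det_fin_two, Matrix.mul_apply,
      Fin.sum_univ_two, Matrix.transpose_apply, Matrix.conjTranspose_apply, Matrix.sub_apply,
      map_add, map_sub, map_mul, hT, RCLike.star_def, Complex.conj_conj]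
    ring
  have := Complex.normSq_nonneg
    ((M.conjTranspose * M * T - T * (M.conjTranspose * M).transpose) 0 1)
  linarith

/-- The discriminant (tr H)² − 4 det H = (H₀₀ − H₁₁)² + 4|H₀₁|² of H = MᴴM is nonnegative. -/
theorem four_mul_normSq_det_le (M : Matrix (Fin 2) (Fin 2) ℂ) :
    4 * Complex.normSq M.det ≤ frobSq M ^ 2 := by
  have key : frobSq M ^ 2 = 4 * Complex.normSq M.det +
      (Complex.normSq (M 0 0) + Complex.normSq (M 1 0) - Complex.normSq (M 0 1) -
        Complex.normSq (M 1 1)) ^ 2 +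
      4 * Complex.normSq (conj (M 0 0) * M 0 1 + conj (M 1 0) * M 1 1) := by
    rw [← Complex.ofReal_inj]
    push_cast
    simp only [ofReal_frobSq, ← Complex.mul_conj, Matrix.det_fin_two, Fin.sum_univ_two,
      map_add, map_sub, map_mul, Complex.conj_conj]
    ring
  have := Complex.normSq_nonneg (conj (M 0 0) * M 0 1 + conj (M 1 0) * M 1 1)
  nlinarith [sq_nonneg (Complex.normSq (M 0 0) + Complex.normSq (M 1 0) -
    Complex.normSq (M 0 1) - Complex.normSq (M 1 1))]

/-! ### Slice forms under local operators, and Heron's product -/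

namespace Tensor

theorem rot_rot_rot (x : Tensor) : x.rot.rot.rot = x := rfl

theorem form_act (M : Matrix (Fin 2) (Fin 2) ℂ) (x : Tensor) :
    (x.act M).form = M * x.form * M.transpose := by
  ext a b
  simp only [form, act, Matrix.mul_apply, Fin.sum_univ_two, Matrix.transpose_apply, Matrix.of_apply]
  ring

/-- Along another qubit, M multiplies every slice on one side, so all slice determinants scale by
det M. -/
theorem form_rot_act (M : Matrix (Fin 2) (Fin 2) ℂ) (x : Tensor) :
    (x.act M).rot.form = M.det • x.rot.form := by
  ext a b
  simp only [form, act, rot, Fin.sum_univ_two, Matrix.of_apply, Matrix.det_fin_two,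
    Matrix.smul_apply, smul_eq_mul]
  ring

theorem form_rot_rot_act (M : Matrix (Fin 2) (Fin 2) ℂ) (x : Tensor) :
    (x.act M).rot.rot.form = M.det • x.rot.rot.form := by
  ext a b
  simp only [form, act, rot, Fin.sum_univ_two, Matrix.of_apply, Matrix.det_fin_two,
    Matrix.smul_apply, smul_eq_mul]
  ring

theorem form_comm (x : Tensor) (a b : Fin 2) : x.form a b = x.form b a := by
  simp only [form, Matrix.of_apply]
  ring

theorem form_rot_of_factor {x : Tensor} {u : Fin 2 → ℂ} {w : Fin 2 → Fin 2 → ℂ}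
    (h : ∀ a b c, x a b c = u a * w b c) : x.rot.form = 0 := by
  ext a b
  simp only [form, rot, h, Matrix.of_apply, Matrix.zero_apply]
  ring

/-- The product of the four factors in Heron's formula. -/
def heron (x : Tensor) : ℝ :=
  frobSq x.form * frobSq x.rot.form * frobSq x.rot.rot.form *
    (frobSq x.form + frobSq x.rot.form + frobSq x.rot.rot.form)

theorem heron_rot (x : Tensor) : x.rot.heron = x.heron := by
  simp only [heron, rot_rot_rot]
  ring

theorem heron_smul (z : ℂ) (x : Tensor) :
    heron (fun a b c => z * x a b c) = Complex.normSq z ^ 8 * x.heron := by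
  have h (x : Tensor) : form (fun a b c => z * x a b c) = z ^ 2 • x.form := by
    ext a b
    simp only [form, Matrix.of_apply, Matrix.smul_apply, smul_eq_mul]
    ring
  have h1 : rot (fun a b c => z * x a b c) = fun a b c => z * x.rot a b c := rfl
  have h2 : rot (fun a b c => z * x.rot a b c) = fun a b c => z * x.rot.rot a b c := rfl
  rw [heron, h1, h2, h, h, h, frobSq_smul, frobSq_smul, frobSq_smul, map_pow, heron]
  ring

theorem heron_nonneg (x : Tensor) : 0 ≤ x.heron := by
  have h1 := frobSq_nonneg x.form
  have h2 := frobSq_nonneg x.rot.form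
  have h3 := frobSq_nonneg x.rot.rot.form
  unfold heron
  positivity

/-- The unnormalized reduced density matrix of the first qubit. -/
def density (x : Tensor) : Matrix (Fin 2) (Fin 2) ℂ :=
  Matrix.of fun a b => ∑ c, ∑ d, x a c d * conj (x b c d)

/-- The `2 × 2` minors of the flattening of a tensor along the first qubit. -/
def minor (x : Tensor) (c d c' d' : Fin 2) : ℂ := x 0 c d * x 1 c' d' - x 1 c d * x 0 c' d'

/-- Cauchy–Binet for the 2×4 flattening. -/
theorem det_density (x : Tensor) :
    x.density.det =
      x.minor 0 0 0 1 * conj (x.minor 0 0 0 1) + x.minor 0 0 1 0 * conj (x.minor 0 0 1 0) +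
      x.minor 0 0 1 1 * conj (x.minor 0 0 1 1) + x.minor 0 1 1 0 * conj (x.minor 0 1 1 0) +
      x.minor 0 1 1 1 * conj (x.minor 0 1 1 1) + x.minor 1 0 1 1 * conj (x.minor 1 0 1 1) := by
  simp only [density, minor, Matrix.det_fin_two, Matrix.of_apply, Fin.sum_univ_two, map_sub,
    map_mul]
  ring

theorem form_rot_apply (x : Tensor) (a b : Fin 2) :
    x.rot.form a b = x.minor a 0 b 1 - x.minor a 1 b 0 := by
  simp only [form, rot, minor, Matrix.of_apply]
  ring

theorem form_rot_rot_apply (x : Tensor) (a b : Fin 2) :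
    x.rot.rot.form a b = x.minor 0 a 1 b - x.minor 1 a 0 b := by
  simp only [form, rot, minor, Matrix.of_apply]
  ring

theorem minor_comm (x : Tensor) (c d c' d' : Fin 2) : x.minor c' d' c d = -x.minor c d c' d' := by
  simp only [minor]
  ring

/-- The diagonal form entries are, up to sign, twice a minor. The off-diagonal ones are the
difference and the sum of the two remaining minors, handled by the parallelogram law. -/
theorem four_mul_det_density (x : Tensor) :
    4 * x.density.det = ((frobSq x.rot.form + frobSq x.rot.rot.form : ℝ) : ℂ) := by
  push_cast
  simp only [ofReal_frobSq, det_density, form_rot_rot_apply]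
  simp only [form_rot_apply, Fin.sum_univ_two, x.minor_comm 0 0, x.minor_comm 0 1 1 0,
    x.minor_comm 0 1 1 1, x.minor_comm 1 0 1 1, map_sub, map_neg]
  ring

/-! ### Growth of Heron's product under a measurement -/

/-- The bound on the eighth root of the growth of `heron` under `act M`: it is linear in `Mᴴ * M`. -/
noncomputable def rate (x : Tensor) (M : Matrix (Fin 2) (Fin 2) ℂ) : ℝ :=
  (frobSq M + frobSq (M * x.form) / frobSq x.form +
    (frobSq M / 2 * (frobSq x.rot.form + frobSq x.rot.rot.form) + frobSq (M * x.form)) /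
      (frobSq x.rot.form + frobSq x.rot.rot.form + frobSq x.form)) / 4

theorem rate_nonneg (x : Tensor) (M : Matrix (Fin 2) (Fin 2) ℂ) : 0 ≤ x.rate M := by
  have h1 := frobSq_nonneg x.form
  have h2 := frobSq_nonneg x.rot.form
  have h3 := frobSq_nonneg x.rot.rot.form
  have h4 := frobSq_nonneg M
  have h5 := frobSq_nonneg (M * x.form)
  unfold rate
  positivity

end Tensor

/-- Here t = ‖M‖²/2, U = ‖MT‖², D = |det M|², Z and Z' are ‖T‖² before and after, and A is the sum
of the other two Z_i. AM–GM is applied to the pairs (DZ, Z') and (D(A+Z), DA+Z'), whose sums are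
bounded by the hypotheses, and finally to t, t, U/Z, (tA+U)/(A+Z). -/
theorem heron_growth_bound {t U D Z Z' A : ℝ} (ht : 0 ≤ t) (hU : 0 ≤ U) (hD : 0 ≤ D) (hZ : 0 < Z)
    (hZ' : 0 ≤ Z') (hA : 0 ≤ A) (hDt : D ≤ t ^ 2) (h : D * Z + Z' ≤ 2 * t * U) :
    D ^ 2 * (D * A + Z') * Z' ≤
      ((2 * t + U / Z + (t * A + U) / (A + Z)) / 4) ^ 8 * ((A + Z) * Z) := by
  have e1 : (D * Z) * Z' ≤ (t * U) ^ 2 := by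
    have : ((D * Z + Z') / 2) ^ 2 ≤ (t * U) ^ 2 := by
      apply pow_le_pow_left₀ (by positivity); linarith
    nlinarith [sq_nonneg (D * Z - Z')]
  have e2 : (D * (A + Z)) * (D * A + Z') ≤ (t * (t * A + U)) ^ 2 := by
    have : ((D * (A + Z) + (D * A + Z')) / 2) ^ 2 ≤ (t * (t * A + U)) ^ 2 := by
      apply pow_le_pow_left₀ (by positivity); nlinarith [mul_le_mul_of_nonneg_right hDt hA]
    nlinarith [sq_nonneg (D * (A + Z) - (D * A + Z'))]
  have hAZ : 0 < A + Z := by positivity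
  obtain ⟨u, rfl⟩ : ∃ u, U = u * Z := ⟨U / Z, by field_simp⟩
  obtain ⟨w, hw⟩ : ∃ w, t * A + u * Z = w * (A + Z) := ⟨(t * A + u * Z) / (A + Z), by field_simp⟩
  have hu : 0 ≤ u := nonneg_of_mul_nonneg_left hU hZ
  have hw0 : 0 ≤ w := nonneg_of_mul_nonneg_left (hw ▸ by positivity) hAZ
  rw [hw] at e2 ⊢
  rw [mul_div_cancel_right₀ _ hZ.ne', mul_div_cancel_right₀ _ hAZ.ne']
  have e1' : D * Z' ≤ (t * u) ^ 2 * Z := by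
    refine le_of_mul_le_mul_right ?_ hZ
    linarith
  have e2' : D * (D * A + Z') ≤ (t * w) ^ 2 * (A + Z) := by
    refine le_of_mul_le_mul_right ?_ hAZ
    linarith
  have amgm : t ^ 2 * u * w ≤ ((2 * t + u + w) / 4) ^ 4 := by
    have a1 : u * w ≤ ((u + w) / 2) ^ 2 := by nlinarith [sq_nonneg (u - w)]
    have a2 : t * ((u + w) / 2) ≤ ((2 * t + u + w) / 4) ^ 2 := by
      nlinarith [sq_nonneg (2 * t - (u + w))]
    calc t ^ 2 * u * w = t ^ 2 * (u * w) := by ring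
      _ ≤ t ^ 2 * ((u + w) / 2) ^ 2 := by gcongr
      _ = (t * ((u + w) / 2)) ^ 2 := by ring
      _ ≤ (((2 * t + u + w) / 4) ^ 2) ^ 2 := by gcongr
      _ = _ := by ring
  calc D ^ 2 * (D * A + Z') * Z' = (D * (D * A + Z')) * (D * Z') := by ring
    _ ≤ ((t * w) ^ 2 * (A + Z)) * ((t * u) ^ 2 * Z) := by gcongr
    _ = (t ^ 2 * u * w) ^ 2 * ((A + Z) * Z) := by ring
    _ ≤ (((2 * t + u + w) / 4) ^ 4) ^ 2 * ((A + Z) * Z) := by gcongr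
    _ = _ := by ring

namespace Tensor

theorem heron_act_le (M : Matrix (Fin 2) (Fin 2) ℂ) (x : Tensor) :
    (x.act M).heron ≤ x.rate M ^ 8 * x.heron := by
  have h1 := frobSq_nonneg x.form
  have h2 := frobSq_nonneg x.rot.form
  have h3 := frobSq_nonneg x.rot.rot.form
  have hM := frobSq_nonneg M
  have hZ' := frobSq_nonneg (M * x.form * M.transpose)
  have hD := Complex.normSq_nonneg M.det
  have key := normSq_det_mul_frobSq_add_le M x.form (x.form_comm 0 1)
  have hdet := four_mul_normSq_det_le M
  simp only [heron, form_act, form_rot_act, form_rot_rot_act, frobSq_smul]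
  rcases h1.eq_or_lt with h0 | hpos
  -- Both sides vanish, so the junk value of the quotient in `rate` is harmless.
  · have : x.form = 0 := frobSq_eq_zero h0.symm
    simp [this, frobSq]
  · have := heron_growth_bound (t := frobSq M / 2) (A := frobSq x.rot.form + frobSq x.rot.rot.form)
      (by positivity) (frobSq_nonneg (M * x.form)) hD hpos hZ' (by positivity)
      (by linarith) (by linarith)
    have := mul_le_mul_of_nonneg_left this (mul_nonneg h2 h3)
    rw [show 2 * (frobSq M / 2) = frobSq M by ring, ← rate] at this
    refine le_trans (le_of_eq ?_) (this.trans (le_of_eq ?_))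
    · ring
    · generalize x.rate M ^ 8 = r
      ring

theorem sum_frobSq_mul {n : ℕ} {M : Fin n → Matrix (Fin 2) (Fin 2) ℂ}
    (hM : ∑ k, (M k).conjTranspose * M k = 1) (T : Matrix (Fin 2) (Fin 2) ℂ) :
    ∑ k, frobSq (M k * T) = frobSq T := by
  have hf (A : Matrix (Fin 2) (Fin 2) ℂ) : frobSq A = (A.conjTranspose * A).trace.re := by
    simp [frobSq, Matrix.trace, Matrix.mul_apply, Fin.sum_univ_two, Complex.normSq_apply]
    ring
  simp only [hf, Matrix.conjTranspose_mul]
  rw [← Complex.re_sum, ← Matrix.trace_sum]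
  have : ∑ k, T.conjTranspose * (M k).conjTranspose * (M k * T) =
      T.conjTranspose * (∑ k, (M k).conjTranspose * M k) * T := by
    simp only [Finset.mul_sum, Finset.sum_mul, Matrix.mul_assoc]
  rw [this, hM, Matrix.mul_one]

theorem sum_rate {n : ℕ} {M : Fin n → Matrix (Fin 2) (Fin 2) ℂ}
    (hM : ∑ k, (M k).conjTranspose * M k = 1) {x : Tensor} (hx : x.form ≠ 0) :
    ∑ k, x.rate (M k) = 1 := by
  have hpos : 0 < frobSq x.form := (frobSq_nonneg _).lt_of_ne fun h => hx (frobSq_eq_zero h.symm)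
  have h2 := frobSq_nonneg x.rot.form
  have h3 := frobSq_nonneg x.rot.rot.form
  -- This is tr 1 = 2, so the three terms of 4 · `rate` sum to 2, 1 and 1.
  have s1 : ∑ k, frobSq (M k) = 2 := by
    simpa [frobSq, Matrix.one_apply, Fin.sum_univ_two, one_add_one_eq_two] using sum_frobSq_mul hM 1
  have hne : frobSq x.rot.form + frobSq x.rot.rot.form + frobSq x.form ≠ 0 := by positivity
  unfold rate
  rw [← Finset.sum_div, Finset.sum_add_distrib, Finset.sum_add_distrib, ← Finset.sum_div,
    ← Finset.sum_div, Finset.sum_add_distrib, ← Finset.sum_mul, ← Finset.sum_div,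
    sum_frobSq_mul hM, s1]
  field_simp
  ring

theorem sum_heron_rpow_le {n : ℕ} {M : Fin n → Matrix (Fin 2) (Fin 2) ℂ}
    (hM : ∑ k, (M k).conjTranspose * M k = 1) (x : Tensor) :
    ∑ k, (x.act (M k)).heron ^ (1 / 8 : ℝ) ≤ x.heron ^ (1 / 8 : ℝ) := by
  have hk (k) : (x.act (M k)).heron ^ (1 / 8 : ℝ) ≤ x.rate (M k) * x.heron ^ (1 / 8 : ℝ) := by
    have h := Real.rpow_le_rpow (heron_nonneg _) (heron_act_le (M k) x)
      (by norm_num : (0 : ℝ) ≤ 1 / 8)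
    rw [Real.mul_rpow (pow_nonneg (rate_nonneg _ _) _) (heron_nonneg _), ← Real.rpow_natCast,
      ← Real.rpow_mul (rate_nonneg _ _)] at h
    norm_num at h
    simpa using h
  refine (Finset.sum_le_sum fun k _ => hk k).trans ?_
  rw [← Finset.sum_mul]
  by_cases hx : x.form = 0
  · have : x.heron = 0 := by simp [heron, hx, frobSq]
    simp [this]
  · rw [sum_rate hM hx, one_mul]

/-- If the product vanished, the growth bound for M⁻¹ would make it vanish for x too. -/
theorem heron_act_pos {M : Matrix (Fin 2) (Fin 2) ℂ} (hM : IsUnit M) {x : Tensor}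
    (hx : 0 < x.heron) : 0 < (x.act M).heron := by
  refine (heron_nonneg _).lt_of_ne fun h => ?_
  have hinv : (x.act M).act M⁻¹ = x := by
    have h1 : M⁻¹ * M = 1 := Matrix.nonsing_inv_mul M ((Matrix.isUnit_iff_isUnit_det M).1 hM)
    funext a b c
    have : (x.act M).act M⁻¹ a b c = ∑ a', (M⁻¹ * M) a a' * x a' b c := by
      simp only [act, Matrix.mul_apply, Fin.sum_univ_two]
      ring
    rw [this, h1]
    simp [Matrix.one_apply]
  have := heron_act_le M⁻¹ (x.act M)
  rw [hinv, ← h, mul_zero] at this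
  linarith

/-! ### Factorization when a slice form vanishes -/

theorem exists_factor {ι : Type*} {f : Fin 2 → ι → ℂ}
    (h : ∀ i j, f 0 i * f 1 j = f 1 i * f 0 j) : ∃ (u : Fin 2 → ℂ) (w : ι → ℂ), ∀ a i, f a i = u a * w i := by
  by_cases h0 : ∃ i, f 0 i ≠ 0
  · obtain ⟨i, hi⟩ := h0
    refine ⟨![1, f 1 i / f 0 i], f 0, fun a j => ?_⟩
    fin_cases a
    · simp
    · have := h i j
      simp
      field_simp
      linear_combination this
  · push Not at h0
    refine ⟨![0, 1], f 1, fun a j => ?_⟩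
    fin_cases a <;> simp [h0]

/-- If the polarized determinant of the slices vanishes, another qubit factors out. -/
theorem exists_factor_of_form_eq_zero {x : Tensor} (hx : x.form = 0) :
    (∃ (u : Fin 2 → ℂ) (w : Fin 2 → Fin 2 → ℂ), ∀ a b c, x.rot a b c = u a * w b c) ∨
    ∃ (u : Fin 2 → ℂ) (w : Fin 2 → Fin 2 → ℂ), ∀ a b c, x.rot.rot a b c = u a * w b c := by
  have hform (a b) : x a 0 0 * x b 1 1 + x a 1 1 * x b 0 0 - x a 0 1 * x b 1 0
      - x a 1 0 * x b 0 1 = 0 := congrFun (congrFun hx a) b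
  -- The diagonal entries are twice the slice determinants, so each slice has rank at most one.
  have hslice (a) : ∃ u w : Fin 2 → ℂ, ∀ b c, x a b c = u b * w c := by
    refine exists_factor fun i j => ?_
    have := hform a a
    fin_cases i <;> fin_cases j <;> simp only [Fin.zero_eta, Fin.mk_one]
    · ring
    · linear_combination this / 2
    · linear_combination -this / 2
    · ring
  obtain ⟨p, q, hpq⟩ := hslice 0
  obtain ⟨r, s, hrs⟩ := hslice 1
  -- For slices p⊗q and r⊗s the off-diagonal entry is (p∧r)(q∧s): either the left or the right
  -- factors are parallel.
  have hprod : (p 0 * r 1 - p 1 * r 0) * (q 0 * s 1 - q 1 * s 0) = 0 := by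
    have := hform 0 1
    simp only [hpq, hrs] at this
    linear_combination this
  rcases mul_eq_zero.1 hprod with h | h
  · left
    obtain ⟨u, w, huw⟩ := exists_factor (f := fun b (i : Fin 2 × Fin 2) => x i.2 b i.1) (by
      rintro ⟨c, a⟩ ⟨c', a'⟩
      fin_cases a <;> fin_cases a' <;> simp only [Fin.zero_eta, Fin.mk_one, hpq, hrs]
      · ring
      · linear_combination (q c * s c') * h
      · linear_combination (-(q c' * s c)) * h
      · ring)
    exact ⟨u, fun c a => w (c, a), fun a b c => huw a (b, c)⟩
  · right
    obtain ⟨u, w, huw⟩ := exists_factor (f := fun c (i : Fin 2 × Fin 2) => x i.1 i.2 c) (by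
      rintro ⟨a, b⟩ ⟨a', b'⟩
      fin_cases a <;> fin_cases a' <;> simp only [Fin.zero_eta, Fin.mk_one, hpq, hrs]
      · ring
      · linear_combination (p b * r b') * h
      · linear_combination (-(p b' * r b)) * h
      · ring)
    exact ⟨u, fun a b => w (a, b), fun a b c => huw a (b, c)⟩

end Tensor

/-! ### From states to tensors: edges and area -/

open scoped ComplexOrder

/-- The amplitudes of `ψ`, with qubit `i` first and the others in cyclic order. -/
def tensor (i : Fin 3) (ψ : Vec) : Tensor := fun a b c => ψ fun j => ![a, b, c] (j - i)

theorem tensor_add_one (i : Fin 3) (ψ : Vec) : tensor (i + 1) ψ = (tensor i ψ).rot := by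
  funext a b c
  simp only [tensor, Tensor.rot]
  refine congrArg ψ (funext fun j => ?_)
  fin_cases i <;> fin_cases j <;> rfl

theorem apply_eq_tensor (i : Fin 3) (ψ : Vec) (s : Fin 3 → Fin 2) :
    ψ s = tensor i ψ (s i) (s (i + 1)) (s (i + 2)) := by
  simp only [tensor]
  refine congrArg ψ (funext fun j => ?_)
  fin_cases i <;> fin_cases j <;> rfl

theorem heron_tensor (i : Fin 3) (ψ : Vec) : (tensor i ψ).heron = (tensor 0 ψ).heron := by
  have h (i : Fin 3) : (tensor (i + 1) ψ).heron = (tensor i ψ).heron := by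
    rw [tensor_add_one, Tensor.heron_rot]
  fin_cases i
  · rfl
  · exact h 0
  · exact (h 1).trans (h 0)

theorem sum_pi_fin_three {α : Type*} [AddCommMonoid α] (i : Fin 3) (f : (Fin 3 → Fin 2) → α) :
    ∑ s, f s = ∑ a, ∑ b, ∑ c, f fun j => ![a, b, c] (j - i) := by
  let e : Fin 2 × Fin 2 × Fin 2 ≃ (Fin 3 → Fin 2) :=
    { toFun := fun p j => ![p.1, p.2.1, p.2.2] (j - i)
      invFun := fun s => (s i, s (i + 1), s (i + 2))
      left_inv := by
        rintro ⟨a, b, c⟩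
        fin_cases i <;> rfl
      right_inv := by
        intro s
        funext j
        fin_cases i <;> fin_cases j <;> rfl }
  rw [← Equiv.sum_comp e]
  simp only [Fintype.sum_prod_type]
  rfl

theorem reducedDensity_eq (i : Fin 3) (ψ : Vec) :
    reducedDensity i ψ = (tensor i ψ).density := by
  ext a b
  have hup (a' c d b : Fin 2) : Function.update (fun j => ![a', c, d] (j - i)) i b =
      fun j => ![b, c, d] (j - i) := by
    funext j
    fin_cases i <;> fin_cases j <;> rfl
  simp only [reducedDensity, Matrix.of_apply, sum_pi_fin_three i, Tensor.density, hup, sub_self,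
    Matrix.cons_val_zero]
  rw [Finset.sum_eq_single a]
  · simp [tensor]
  · intro a' _ h
    simp [h]
  · simp

theorem trace_reducedDensity (i : Fin 3) {ψ : Vec} (hψ : ‖ψ‖ = 1) :
    (reducedDensity i ψ).trace = 1 := by
  have h : (∑ s, ‖ψ s‖ ^ 2 : ℝ) = 1 := by
    rw [← EuclideanSpace.norm_sq_eq, hψ, one_pow]
  have h2 : ∑ s, ψ s * conj (ψ s) = 1 := by
    simp only [Complex.mul_conj, Complex.normSq_eq_norm_sq]
    exact_mod_cast h
  rw [reducedDensity_eq, ← h2, sum_pi_fin_three i]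
  simp [Matrix.trace, Tensor.density, tensor]

theorem edge_eq (i : Fin 3) {ψ : Vec} (hψ : ‖ψ‖ = 1) :
    edge i ψ = frobSq (tensor i ψ).rot.form + frobSq (tensor i ψ).rot.rot.form := by
  have h1 := trace_reducedDensity i hψ
  have h2 := (tensor i ψ).four_mul_det_density
  have h3 : 2 * (1 - (reducedDensity i ψ * reducedDensity i ψ).trace) =
      4 * (tensor i ψ).density.det := by
    rw [← reducedDensity_eq]
    generalize reducedDensity i ψ = ρ at *
    simp only [Matrix.trace, Matrix.mul_apply, Fin.sum_univ_two, Matrix.det_fin_two,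
      Matrix.diag_apply] at *
    -- Since tr ρ² = (tr ρ)² − 2 det ρ, the difference is 2(1 − (tr ρ)²) = −2(tr ρ + 1)(tr ρ − 1).
    linear_combination (-2 : ℂ) * (ρ 0 0 + ρ 1 1 + 1) * h1
  have h4 := congrArg Complex.re (h3.trans h2)
  rw [Complex.ofReal_re] at h4
  have h5 := frobSq_nonneg (tensor i ψ).rot.form
  have h6 := frobSq_nonneg (tensor i ψ).rot.rot.form
  have h7 : 2 * (1 - (reducedDensity i ψ * reducedDensity i ψ).trace.re) =
      frobSq (tensor i ψ).rot.form + frobSq (tensor i ψ).rot.rot.form := by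
    rw [← h4]
    simp
  rw [edge, concurrence, h7, Real.sq_sqrt (by positivity)]

theorem edge_eq_add (i : Fin 3) {ψ : Vec} (hψ : ‖ψ‖ = 1) :
    edge i ψ = frobSq (tensor (i + 1) ψ).form + frobSq (tensor (i + 2) ψ).form := by
  rw [edge_eq i hψ, ← tensor_add_one, ← tensor_add_one, add_assoc]
  rfl

theorem edge_le_add {ψ : Vec} (hψ : ‖ψ‖ = 1) {i j k : Fin 3} (hij : i ≠ j) (hjk : j ≠ k)
    (hik : i ≠ k) : edge i ψ ≤ edge j ψ + edge k ψ := by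
  have h0 := frobSq_nonneg (tensor 0 ψ).form
  have h1 := frobSq_nonneg (tensor 1 ψ).form
  have h2 := frobSq_nonneg (tensor 2 ψ).form
  have e0 : edge 0 ψ = frobSq (tensor 1 ψ).form + frobSq (tensor 2 ψ).form := edge_eq_add 0 hψ
  have e1 : edge 1 ψ = frobSq (tensor 2 ψ).form + frobSq (tensor 0 ψ).form := edge_eq_add 1 hψ
  have e2 : edge 2 ψ = frobSq (tensor 0 ψ).form + frobSq (tensor 1 ψ).form := edge_eq_add 2 hψ
  fin_cases i <;> fin_cases j <;> fin_cases k <;> simp_all <;> linarith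

theorem concurrenceFill_eq {ψ : Vec} (hψ : ‖ψ‖ = 1) :
    concurrenceFill ψ = 4 / Real.sqrt 3 * Real.sqrt (tensor 0 ψ).heron := by
  have e0 : edge 0 ψ = frobSq (tensor 1 ψ).form + frobSq (tensor 2 ψ).form := edge_eq_add 0 hψ
  have e1 : edge 1 ψ = frobSq (tensor 2 ψ).form + frobSq (tensor 0 ψ).form := edge_eq_add 1 hψ
  have e2 : edge 2 ψ = frobSq (tensor 0 ψ).form + frobSq (tensor 1 ψ).form := edge_eq_add 2 hψ
  have t1 : (tensor 0 ψ).rot = tensor 1 ψ := (tensor_add_one 0 ψ).symm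
  have t2 : (tensor 1 ψ).rot = tensor 2 ψ := (tensor_add_one 1 ψ).symm
  rw [concurrenceFill, halfPerimeter, e0, e1, e2, Tensor.heron, t1, t2]
  congr 2
  ring

/-! ### Biseparable states and the GHZ and W classes -/

theorem isBiseparable_iff (ψ : Vec) : IsBiseparable ψ ↔
    ∃ (i : Fin 3) (u : Fin 2 → ℂ) (w : Fin 2 → Fin 2 → ℂ),
      ∀ a b c, tensor i ψ a b c = u a * w b c := by
  constructor
  · rintro ⟨i, u, v, h⟩
    refine ⟨i, u, fun b c => v fun j => ![0, b, c] (j - i), fun a b c => ?_⟩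
    rw [tensor, h]
    congr 1
    · simp
    · congr 1
      funext ⟨j, hj⟩
      fin_cases i <;> fin_cases j <;> first | rfl | exact absurd rfl hj
  · rintro ⟨i, u, w, h⟩
    have h1 : i + 1 ≠ i := by fin_cases i <;> decide
    have h2 : i + 2 ≠ i := by fin_cases i <;> decide
    exact ⟨i, u, fun t => w (t ⟨i + 1, h1⟩) (t ⟨i + 2, h2⟩), fun s => by
      rw [apply_eq_tensor i ψ s, h]⟩

theorem IsProduct.isBiseparable {ψ : Vec} (h : IsProduct ψ) : IsBiseparable ψ := by
  obtain ⟨u, hu⟩ := h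
  refine (isBiseparable_iff ψ).2 ⟨0, u 0, fun b c => u 1 b * u 2 c, fun a b c => ?_⟩
  rw [tensor, hu, Fin.prod_univ_three, mul_assoc]
  rfl

theorem heron_eq_zero_iff (ψ : Vec) : (tensor 0 ψ).heron = 0 ↔ IsBiseparable ψ := by
  rw [isBiseparable_iff]
  constructor
  · intro h
    have key : ∃ i, (tensor i ψ).form = 0 := by
      have h0 := frobSq_nonneg (tensor 0 ψ).form
      have h1 := frobSq_nonneg (tensor 0 ψ).rot.form
      have h2 := frobSq_nonneg (tensor 0 ψ).rot.rot.form
      rcases mul_eq_zero.1 h with h | h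
      · rcases mul_eq_zero.1 h with h | h
        · rcases mul_eq_zero.1 h with h | h
          · exact ⟨0, frobSq_eq_zero h⟩
          · exact ⟨0 + 1, frobSq_eq_zero (by rwa [tensor_add_one])⟩
        · exact ⟨0 + 1 + 1, frobSq_eq_zero (by rwa [tensor_add_one, tensor_add_one])⟩
      · exact ⟨0, frobSq_eq_zero (by linarith)⟩
    obtain ⟨i, hi⟩ := key
    rcases Tensor.exists_factor_of_form_eq_zero hi with ⟨u, w, h⟩ | ⟨u, w, h⟩
    · exact ⟨i + 1, u, w, by rwa [tensor_add_one]⟩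
    · exact ⟨i + 1 + 1, u, w, by rwa [tensor_add_one, tensor_add_one]⟩
  · rintro ⟨i, u, w, h⟩
    rw [← heron_tensor i, Tensor.heron, Tensor.form_rot_of_factor h]
    simp [frobSq]

theorem heron_pos_of_inClassOf {χ ψ : Vec} (h : InClassOf χ ψ) (hχ : 0 < (tensor 0 χ).heron) :
    0 < (tensor 0 ψ).heron := by
  obtain ⟨A, hA, h⟩ := h
  have key : (tensor 0 ψ) =
      ((((((tensor 0 χ).act (A 0)).rot).act (A 1)).rot).act (A 2)).rot := by
    funext a b c
    simp only [tensor, h, sum_pi_fin_three 0, Tensor.act, Tensor.rot, Fin.prod_univ_three,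
      Fin.sum_univ_two, sub_zero, Matrix.cons_val_zero, Matrix.cons_val_one, Matrix.cons_val]
    ring
  rw [key, Tensor.heron_rot]
  refine Tensor.heron_act_pos (hA 2) ?_
  rw [Tensor.heron_rot]
  refine Tensor.heron_act_pos (hA 1) ?_
  rw [Tensor.heron_rot]
  exact Tensor.heron_act_pos (hA 0) hχ

theorem Tensor.heron_pos_of_rot_eq {x : Tensor} (hx : x.rot = x) {a b : Fin 2}
    (h : x.form a b ≠ 0) : 0 < x.heron := by
  have hpos : 0 < frobSq x.form := (frobSq_nonneg _).lt_of_ne fun h0 => h <| by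
    rw [frobSq_eq_zero h0.symm, Matrix.zero_apply]
  rw [Tensor.heron, hx, hx]
  positivity

theorem heron_ghz_pos : 0 < (tensor 0 ghz).heron := by
  have h : (tensor 0 ghz).rot = tensor 0 ghz := by
    funext a b c
    fin_cases a <;> fin_cases b <;> fin_cases c <;>
      simp [tensor, Tensor.rot, ghz, funext_iff, Fin.forall_fin_succ]
  refine Tensor.heron_pos_of_rot_eq h (a := 0) (b := 1) ?_
  simp [tensor, Tensor.form, ghz, funext_iff, Fin.forall_fin_succ]

theorem heron_wState_pos : 0 < (tensor 0 wState).heron := by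
  have h : (tensor 0 wState).rot = tensor 0 wState := by
    funext a b c
    fin_cases a <;> fin_cases b <;> fin_cases c <;>
      simp [tensor, Tensor.rot, wState, funext_iff, Fin.forall_fin_succ]
  refine Tensor.heron_pos_of_rot_eq h (a := 0) (b := 0) ?_
  simp [tensor, Tensor.form, wState, funext_iff, Fin.forall_fin_succ]
  rw [← neg_add', neg_eq_zero, ← two_mul]
  simp

/-! ### Monotonicity under LOCC -/

/-- The action of `localOp i M` on vectors. -/
def applyLocal (i : Fin 3) (M : Matrix (Fin 2) (Fin 2) ℂ) (ψ : Vec) : Vec :=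
  WithLp.toLp 2 ((localOp i M).mulVec ψ)

theorem tensor_applyLocal (i : Fin 3) (M : Matrix (Fin 2) (Fin 2) ℂ) (ψ : Vec) :
    tensor i (applyLocal i M ψ) = (tensor i ψ).act M := by
  funext a b c
  have hcond (a b c a' b' c' : Fin 2) : (∀ j, j ≠ i →
      (![a, b, c] (j - i) : Fin 2) = ![a', b', c'] (j - i)) ↔ b = b' ∧ c = c' := by
    constructor
    · intro h
      have h1 := h (i + 1) (by fin_cases i <;> decide)
      have h2 := h (i + 2) (by fin_cases i <;> decide)
      rw [add_sub_cancel_left] at h1 h2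
      exact ⟨h1, h2⟩
    · rintro ⟨rfl, rfl⟩ j hj
      fin_cases i <;> fin_cases j <;> first | rfl | exact absurd rfl hj
  simp only [tensor, applyLocal, Matrix.mulVec, dotProduct, localOp, Matrix.of_apply,
    sum_pi_fin_three i, hcond, Tensor.act, sub_self, Matrix.cons_val_zero]
  refine Finset.sum_congr rfl fun a' _ => ?_
  simp [ite_and]

theorem pureDensity_eq (ψ : Vec) : pureDensity ψ = Matrix.vecMulVec ψ (star ψ) := rfl

theorem localOp_mul_pureDensity (i : Fin 3) (M : Matrix (Fin 2) (Fin 2) ℂ) (ψ : Vec) :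
    localOp i M * pureDensity ψ * (localOp i M).conjTranspose = pureDensity (applyLocal i M ψ) := by
  rw [pureDensity_eq, pureDensity_eq, Matrix.mul_vecMulVec, Matrix.vecMulVec_mul]
  congr 1
  rw [← Matrix.star_mulVec]
  rfl

theorem LOCCProtocol.posSemidef_channel (P : LOCCProtocol) :
    ∀ {ρ : Matrix (Fin 3 → Fin 2) (Fin 3 → Fin 2) ℂ}, ρ.PosSemidef → (P.channel ρ).PosSemidef := by
  induction P with
  | halt => exact fun h => h
  | measure i n M hM next ih =>
    exact fun h => Matrix.posSemidef_sum _ fun k _ => ih k (h.mul_mul_conjTranspose_same _)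

/-- A positive semidefinite summand of a multiple of a rank-one projection is a multiple of it. -/
theorem eq_smul_pureDensity {φ : Vec} (hφ : ‖φ‖ = 1) {c : ℝ}
    {A B : Matrix (Fin 3 → Fin 2) (Fin 3 → Fin 2) ℂ} (hA : A.PosSemidef) (hB : B.PosSemidef)
    (h : A + B = (c : ℂ) • pureDensity φ) : ∃ a : ℝ, A = (a : ℂ) • pureDensity φ := by
  have hnorm : star (φ : _ → ℂ) ⬝ᵥ φ = 1 := by
    have h1 : (∑ s, ‖φ s‖ ^ 2 : ℝ) = 1 := by rw [← EuclideanSpace.norm_sq_eq, hφ, one_pow]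
    simp only [dotProduct, Pi.star_apply, RCLike.star_def, Complex.conj_mul']
    exact_mod_cast h1
  -- On φ^⊥ the nonnegative quadratic forms of A and B sum to zero, so A kills φ^⊥; hermiticity then
  -- puts its range in ℂφ.
  have hker (x : (Fin 3 → Fin 2) → ℂ) (hx : star (φ : _ → ℂ) ⬝ᵥ x = 0) : A.mulVec x = 0 := by
    have h0 : star x ⬝ᵥ A.mulVec x + star x ⬝ᵥ B.mulVec x = 0 := by
      rw [← dotProduct_add, ← Matrix.add_mulVec, h, pureDensity_eq, Matrix.smul_mulVec,
        Matrix.vecMulVec_mulVec, hx]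
      simp
    rw [← hA.dotProduct_mulVec_zero_iff]
    exact ((add_eq_zero_iff_of_nonneg (hA.dotProduct_mulVec_nonneg x)
      (hB.dotProduct_mulVec_nonneg x)).1 h0).1
  have hcol : A = Matrix.vecMulVec (A.mulVec φ) (star φ) := by
    refine Matrix.ext_iff_mulVec.2 fun y => ?_
    have := hker (y - (star (φ : _ → ℂ) ⬝ᵥ y) • (φ : _ → ℂ)) (by
      rw [dotProduct_sub, dotProduct_smul, hnorm, smul_eq_mul, mul_one, sub_self])
    rw [Matrix.mulVec_sub, Matrix.mulVec_smul, sub_eq_zero] at this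
    rw [this, Matrix.vecMulVec_mulVec]
    simp
  have hvec : A.mulVec φ = (star (A.mulVec φ) ⬝ᵥ φ) • (φ : _ → ℂ) := by
    have h1 : A = Matrix.vecMulVec φ (star (A.mulVec φ)) := by
      conv_lhs => rw [← hA.isHermitian.eq, hcol]
      rw [Matrix.conjTranspose_vecMulVec, star_star]
    have h2 := congrArg (fun A : Matrix _ _ ℂ => A.mulVec φ) h1
    simp only [Matrix.vecMulVec_mulVec] at h2
    exact h2.trans (op_smul_eq_smul _ _)
  have hreal : ((star (A.mulVec φ) ⬝ᵥ φ).re : ℂ) = star (A.mulVec φ) ⬝ᵥ φ := by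
    have h1 := hA.dotProduct_mulVec_nonneg (φ : _ → ℂ)
    have h2 : star (A.mulVec φ) ⬝ᵥ (φ : _ → ℂ) = star (φ : _ → ℂ) ⬝ᵥ A.mulVec φ := by
      rw [Matrix.star_mulVec, hA.isHermitian.eq, Matrix.dotProduct_mulVec]
    rw [h2]
    exact (Complex.eq_re_of_ofReal_le h1).symm
  refine ⟨(star (A.mulVec φ) ⬝ᵥ φ).re, ?_⟩
  rw [hreal, pureDensity_eq, ← Matrix.smul_vecMulVec, ← hvec]
  exact hcol

theorem posSemidef_pureDensity (ψ : Vec) : (pureDensity ψ).PosSemidef :=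
  Matrix.posSemidef_vecMulVec_self_star _

theorem pureDensity_ne_zero {φ : Vec} (hφ : ‖φ‖ = 1) : pureDensity φ ≠ 0 := by
  intro h
  have : φ = 0 := by
    ext s
    simpa [pureDensity] using congrFun (congrFun h s) s
  simp [this] at hφ

theorem exists_smul_of_pureDensity_eq {ψ φ : Vec} (hφ : ‖φ‖ = 1) {c : ℝ} (hc : c ≠ 0)
    (h : pureDensity ψ = (c : ℂ) • pureDensity φ) :
    ∃ z : ℂ, Complex.normSq z = c ∧ ∀ s, ψ s = z * φ s := by
  have hentry (s t) : ψ s * conj (ψ t) = c * (φ s * conj (φ t)) := congrFun (congrFun h s) t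
  obtain ⟨t, ht⟩ : ∃ t, φ t ≠ 0 := by
    by_contra! h0
    have : φ = 0 := by
      ext s
      exact h0 s
    simp [this] at hφ
  have hnorm : Complex.normSq (ψ t) = c * Complex.normSq (φ t) := by
    have := hentry t t
    rw [Complex.mul_conj, Complex.mul_conj, ← Complex.ofReal_mul] at this
    exact Complex.ofReal_injective this
  have hφt : Complex.normSq (φ t) ≠ 0 := by simpa using ht
  have hψt : Complex.normSq (ψ t) ≠ 0 := by
    rw [hnorm]
    exact mul_ne_zero hc hφt
  have hψt' : conj (ψ t) ≠ 0 := by simpa using hψt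
  refine ⟨c * conj (φ t) / conj (ψ t), ?_, fun s => ?_⟩
  · rw [Complex.normSq_div, Complex.normSq_mul, Complex.normSq_conj, Complex.normSq_conj,
      Complex.normSq_ofReal, hnorm]
    field_simp
  · rw [div_mul_eq_mul_div, eq_div_iff hψt', hentry]
    ring

theorem sum_heron_applyLocal_rpow_le (i : Fin 3) {n : ℕ} {M : Fin n → Matrix (Fin 2) (Fin 2) ℂ}
    (hM : ∑ k, (M k).conjTranspose * M k = 1) (ψ : Vec) :
    ∑ k, (tensor 0 (applyLocal i (M k) ψ)).heron ^ (1 / 8 : ℝ) ≤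
      (tensor 0 ψ).heron ^ (1 / 8 : ℝ) := by
  simpa only [← heron_tensor i, tensor_applyLocal] using Tensor.sum_heron_rpow_le hM (tensor i ψ)

/-- The weight c and the unnormalized ψ make the induction work: each branch carries its own
probability. -/
theorem LOCCProtocol.mul_heron_rpow_le (P : LOCCProtocol) {φ : Vec} (hφ : ‖φ‖ = 1) :
    ∀ (ψ : Vec) (c : ℝ), P.channel (pureDensity ψ) = (c : ℂ) • pureDensity φ →
      c * (tensor 0 φ).heron ^ (1 / 8 : ℝ) ≤ (tensor 0 ψ).heron ^ (1 / 8 : ℝ) := by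
  have hne := pureDensity_ne_zero hφ
  induction P with
  | halt =>
    intro ψ c h
    rcases eq_or_ne c 0 with rfl | hc
    · rw [zero_mul]
      exact Real.rpow_nonneg (Tensor.heron_nonneg _) _
    obtain ⟨z, hz, hzψ⟩ := exists_smul_of_pureDensity_eq hφ hc h
    have hc0 : 0 ≤ c := hz ▸ Complex.normSq_nonneg z
    have : tensor 0 ψ = fun a b c => z * tensor 0 φ a b c := by
      funext a b c
      exact hzψ _
    rw [this, Tensor.heron_smul, hz, Real.mul_rpow (by positivity) (Tensor.heron_nonneg _),
      ← Real.rpow_natCast, ← Real.rpow_mul hc0]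
    norm_num
  | measure i n M hM next ih =>
    intro ψ c h
    simp only [LOCCProtocol.channel, localOp_mul_pureDensity] at h
    have hk (k) : ∃ a : ℝ, (next k).channel (pureDensity (applyLocal i (M k) ψ)) =
        (a : ℂ) • pureDensity φ := by
      -- Branch k and the sum of all the others are positive semidefinite summands of c|φ⟩⟨φ|.
      refine eq_smul_pureDensity hφ ((next k).posSemidef_channel (posSemidef_pureDensity _))
        (Matrix.posSemidef_sum (Finset.univ.erase k) fun l _ =>
          (next l).posSemidef_channel (posSemidef_pureDensity (applyLocal i (M l) ψ))) ?_ (c := c)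
      exact (Finset.add_sum_erase Finset.univ (fun l => (next l).channel
        (pureDensity (applyLocal i (M l) ψ))) (Finset.mem_univ k)).trans h
    choose a ha using hk
    have hc : ∑ k, a k = c := by
      simp only [ha, ← Finset.sum_smul] at h
      have := smul_left_injective ℂ hne h
      exact_mod_cast this
    rw [← hc, Finset.sum_mul]
    exact (Finset.sum_le_sum fun k _ => ih k _ _ (ha k)).trans
      (sum_heron_applyLocal_rpow_le i hM ψ)

theorem LOCCProtocol.concurrenceFill_le (P : LOCCProtocol) {ψ φ : Vec} (hψ : ‖ψ‖ = 1)
    (hφ : ‖φ‖ = 1) (h : P.channel (pureDensity ψ) = pureDensity φ) :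
    concurrenceFill φ ≤ concurrenceFill ψ := by
  have := P.mul_heron_rpow_le hφ ψ 1 (by simpa using h)
  rw [one_mul, Real.rpow_le_rpow_iff (Tensor.heron_nonneg _) (Tensor.heron_nonneg _)
    (by norm_num)] at this
  rw [concurrenceFill_eq hψ, concurrenceFill_eq hφ]
  gcongr

theorem concurrenceFill_pos_of_heron_pos {ψ : Vec} (hψ : ‖ψ‖ = 1) (h : 0 < (tensor 0 ψ).heron) :
    0 < concurrenceFill ψ := by
  rw [concurrenceFill_eq hψ]
  positivity

theorem isGenuineTripartiteMeasure_concurrenceFill :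
    IsGenuineTripartiteMeasure concurrenceFill where
  eq_zero ψ hψ h := by
    have hb : IsBiseparable ψ := h.elim IsProduct.isBiseparable id
    rw [concurrenceFill_eq hψ, (heron_eq_zero_iff ψ).2 hb, Real.sqrt_zero, mul_zero]
  pos ψ hψ _ h := concurrenceFill_pos_of_heron_pos hψ <|
    (Tensor.heron_nonneg _).lt_of_ne' (mt (heron_eq_zero_iff ψ).1 h)
  pos_of_class ψ hψ h := concurrenceFill_pos_of_heron_pos hψ <|
    h.elim (fun h => heron_pos_of_inClassOf h heron_ghz_pos)
      (fun h => heron_pos_of_inClassOf h heron_wState_pos)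
  locc_mono P _ _ hψ hφ h := P.concurrenceFill_le hψ hφ h

end ThreeQubit

theorem theorem2 :
    -- the squared one-to-other concurrences are the edge lengths of a triangle
    (∀ ψ : ThreeQubit.Vec, ‖ψ‖ = 1 → ∀ i j k : Fin 3, i ≠ j → j ≠ k → i ≠ k →
      ThreeQubit.edge i ψ ≤ ThreeQubit.edge j ψ + ThreeQubit.edge k ψ) ∧
    -- its normalized area is a genuine tripartite entanglement measure
    ThreeQubit.IsGenuineTripartiteMeasure ThreeQubit.concurrenceFill :=
  ⟨fun _ hψ _ _ _ hij hjk hik => ThreeQubit.edge_le_add hψ hij hjk hik,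
    ThreeQubit.isGenuineTripartiteMeasure_concurrenceFill⟩
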